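/- Let $\mathcal W\subset\mathbb R^2$ be a closed polygonal environment (possibly with holes). For $r>0$, a configuration $\mathbf p=(p_1,\dots,p_k)\in(\mathbb R^2)^k$ of $k\ge 1$ axis-aligned square robots of radius $r$ is *free* if $p_i+[-r,r]^2\subseteq \mathcal W$ for all $i$ and $\|p_i-p_j\|_\infty\ge 2r$ for all $i\ne j$. For configurations $\mathbf s,\mathbf t$, an $(\mathbf s,\mathbf t)$-*plan* is a continuous map $\pi=(\pi_1,\dots,\pi_k):[0,T]\to \mathcal W^k$ (for some $T\ge 0$) with $\pi(0)=\mathbf s$ and $\pi(T)=\mathbf t$; it is *feasible* for radius $r$ if all $\pi(\lambda)$ are free for radius $r$, and its *cost* is the sum of the Euclidean arc-lengths of $\pi_1,\dots,\pi_k$. Let $\mathrm{OPT}(\mathbf s,\mathbf t,r)$ be the least (infimum) cost of an $(\mathbf s,\mathbf t)$-plan that is feasible for radius $r$. For $\rho>0$, the pair $(\mathbf s,\mathbf t)$ is *$\rho$-reachable* if some $(\mathbf s,\mathbf t)$-plan is feasible both for radius $1$ and for radius $1+\rho$. The *breakpoints* of a piecewise-linear plan are its vertices, including its two ends. There is an absolute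 constant $C$ such that the following holds for all $k\ge1$, all $\rho>0$, all closed polygonal environments $\mathcal W$ and all configurations $\mathbf s,\mathbf t$ that are free for radius $1$. If $(\mathbf s,\mathbf t)$ is $\rho$-reachable, then there is a piecewise-linear $(\mathbf s,\mathbf t)$-plan $\pi$, feasible for radius $1$, with $\mathrm{cost}(\pi)\le \mathrm{OPT}(\mathbf s,\mathbf t,1+\rho)$ and with at most $f(k,\rho)\cdot(\mathrm{cost}(\pi)+1)$ breakpoints, where $$f(k,\rho)=\max\{2,\,k/\rho\}^{\,C k^2},$$ so that $f(k,\rho)=(k/\rho)^{Ck^2}=(k/\rho)^{O(k^2)}$ whenever $k\ge 2\rho$. -/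

import Mathlib

open scoped ENNReal

noncomputable section

namespace MinSum

/-- The Euclidean plane. -/
abbrev Pt : Type := EuclideanSpace ℝ (Fin 2)

/-- Joint configurations of `k` robots (the tuple of the centers of the robots). -/
abbrev Config (k : ℕ) : Type := Fin k → Pt

/-- Closed half-planes. -/
def IsHalfPlane (H : Set Pt) : Prop :=
  ∃ a b c : ℝ, (a ≠ 0 ∨ b ≠ 0) ∧ H = {x : Pt | a * x 0 + b * x 1 ≤ c}

/-- Closed convex polygonal regions: intersections of finitely many closed half-planes. -/
def IsConvexPolygonalRegion (K : Set Pt) : Prop :=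
  ∃ A : Set (Set Pt), A.Finite ∧ (∀ H ∈ A, IsHalfPlane H) ∧ K = ⋂₀ A

/-- Closed polygonal environments: finite unions of closed convex polygonal regions.  Every closed
polygon, possibly with (open polygonal) holes, is of this form, since it can be triangulated;
unbounded environments are allowed as well. -/
def IsPolygonalEnvironment (P : Set Pt) : Prop :=
  ∃ B : Set (Set Pt), B.Finite ∧ (∀ K ∈ B, IsConvexPolygonalRegion K) ∧ P = ⋃₀ B

/-- The `ℓ_∞`-distance in the plane. -/
def linfDist (p q : Pt) : ℝ := max |p 0 - q 0| |p 1 - q 1|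

/-- The closed axis-aligned square of radius `r` centered at `p`. -/
def square (p : Pt) (r : ℝ) : Set Pt := {x : Pt | linfDist x p ≤ r}

/-- The free space in `P` of a single square robot of radius `r`. -/
def freeSpace (P : Set Pt) (r : ℝ) : Set Pt := {p : Pt | square p r ⊆ P}

/-- The free configurations in `P` of `k` square robots of radius `r`: every robot is inside `P`,
and the interiors of the robots are pairwise disjoint. -/
def freeConfigs (P : Set Pt) (k : ℕ) (r : ℝ) : Set (Config k) :=
  {p : Config k | (∀ i, p i ∈ freeSpace P r) ∧ ∀ i j, i ≠ j → 2 * r ≤ linfDist (p i) (p j)}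

/-- An `(s, t)`-plan in `P`: a continuous map `[0, T] → P ^ k` from `s` to `t`
(the values of `toFun` outside `[0, T]` play no role). -/
structure Plan (P : Set Pt) {k : ℕ} (s t : Config k) where
  T : ℝ
  T_nonneg : 0 ≤ T
  toFun : ℝ → Config k
  continuousOn : ContinuousOn toFun (Set.Icc 0 T)
  mem : ∀ u ∈ Set.Icc 0 T, ∀ i, toFun u i ∈ P
  source : toFun 0 = s
  target : toFun T = t

namespace Plan

variable {P : Set Pt} {k : ℕ} {s t : Config k}

/-- The plan is feasible for square robots of radius `r`. -/
def Feasible (π : Plan P s t) (r : ℝ) : Prop :=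
  ∀ u ∈ Set.Icc 0 π.T, π.toFun u ∈ freeConfigs P k r

/-- A feasible plan for unit squares is `ρ`-robust if it is also feasible for squares of
radius `1 + ρ`. -/
def Robust (π : Plan P s t) (ρ : ℝ) : Prop :=
  π.Feasible 1 ∧ π.Feasible (1 + ρ)

/-- The cost of a plan: the sum of the (Euclidean) arc-lengths of the paths of the robots. -/
def cost (π : Plan P s t) : ℝ≥0∞ :=
  ∑ i : Fin k, eVariationOn (fun u => π.toFun u i) (Set.Icc 0 π.T)

/-- The plan is linear (that is, affine in the time) on the set `I` of times. -/
def LinearOn (π : Plan P s t) (I : Set ℝ) : Prop :=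
  ∃ a b : Config k, ∀ u ∈ I, π.toFun u = a + u • b

/-- The plan is piecewise linear: `[0, T]` has a finite subdivision
`0 = τ 0 < ... < τ m = T` such that the plan is linear on each interval of it. -/
def PiecewiseLinear (π : Plan P s t) : Prop :=
  ∃ (m : ℕ) (τ : Fin (m + 1) → ℝ), StrictMono τ ∧ τ 0 = 0 ∧ τ (Fin.last m) = π.T ∧
    ∀ j : Fin m, π.LinearOn (Set.Icc (τ j.castSucc) (τ j.succ))

/-- The times of the breakpoints (vertices) of a plan: the times in `[0, T]` around which the plan
is not linear.  The end times `0` and `T` always belong to this set. -/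
def breakTimes (π : Plan P s t) : Set ℝ :=
  {u | u ∈ Set.Icc 0 π.T ∧ ¬ ∃ ε > 0, Set.Icc (u - ε) (u + ε) ⊆ Set.Icc 0 π.T ∧
    π.LinearOn (Set.Icc (u - ε) (u + ε))}

/-- The number of breakpoints of a plan, its endpoints included. -/
def numBreakpoints (π : Plan P s t) : ℕ∞ := π.breakTimes.encard

end Plan

/-- The pair `(s, t)` is `ρ`-reachable: there is a `ρ`-robust `(s, t)`-plan. -/
def RobustlyReachable (P : Set Pt) {k : ℕ} (s t : Config k) (ρ : ℝ) : Prop :=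
  ∃ π : Plan P s t, π.Robust ρ

/-- The optimal (infimum) cost of an `(s, t)`-plan that is feasible for square robots of radius `r`
(`∞` if there is none). -/
def OPT (P : Set Pt) {k : ℕ} (s t : Config k) (r : ℝ) : ℝ≥0∞ :=
  ⨅ (π : Plan P s t) (_ : π.Feasible r), π.cost

end MinSum

end

open MinSum

namespace MinSum

variable {k : ℕ}

/-! ### Free configurations -/

/-! The slack `ρ` buys polygonal motion: if a configuration is free for radius `1 + ρ`, every
configuration within `ρ` of it is free for radius `1` (`mem_freeConfigs_of_dist_le`). So a chain of
`1 + ρ`-free configurations with steps at most `ρ` can be joined by segments. Sampling a plan finely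
yields such a chain, no longer than the plan. Dropping a vertex whose neighbours are within `ρ`
never lengthens it; when none is left, any two consecutive steps have total length above `ρ`, so a
chain of length `L` has at most `2L/ρ + 1` steps (`IsStepChain.exists_short`). Near-optimal plans
thus give chains with uniformly many steps, and compactness gives one of length at most `OPT`
(`exists_isStepChain_le_OPT`). Its polygonal line is the plan; the resulting bound, linear in `1/ρ`,
is far below `f(k, ρ)`. -/

lemma abs_apply_sub_le (p q : Pt) (l : Fin 2) : |p l - q l| ≤ dist p q := by
  rw [EuclideanSpace.dist_eq]
  refine Real.abs_le_sqrt ?_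
  have := Finset.single_le_sum (f := fun i => dist (p i) (q i) ^ 2)
    (fun i _ => sq_nonneg _) (Finset.mem_univ l)
  simpa [Real.dist_eq, sq_abs] using this

lemma linfDist_le_dist (p q : Pt) : linfDist p q ≤ dist p q :=
  max_le (abs_apply_sub_le p q 0) (abs_apply_sub_le p q 1)

lemma linfDist_triangle (p q r : Pt) : linfDist p r ≤ linfDist p q + linfDist q r := by
  refine max_le ?_ ?_
  · exact (abs_sub_le _ (q 0) _).trans (add_le_add (le_max_left _ _) (le_max_left _ _))
  · exact (abs_sub_le _ (q 1) _).trans (add_le_add (le_max_right _ _) (le_max_right _ _))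

lemma linfDist_comm (p q : Pt) : linfDist p q = linfDist q p := by
  simp only [linfDist, abs_sub_comm]

lemma IsHalfPlane.isClosed {H : Set Pt} (hH : IsHalfPlane H) : IsClosed H := by
  obtain ⟨a, b, c, -, rfl⟩ := hH
  exact isClosed_le (by fun_prop) continuous_const

lemma IsPolygonalEnvironment.isClosed {P : Set Pt} (hP : IsPolygonalEnvironment P) :
    IsClosed P := by
  obtain ⟨B, hB, hK, rfl⟩ := hP
  rw [Set.sUnion_eq_biUnion]
  refine Set.Finite.isClosed_biUnion hB fun K hKB => ?_
  obtain ⟨A, -, hA, rfl⟩ := hK K hKB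
  exact isClosed_sInter fun H hH => (hA H hH).isClosed

lemma isClosed_freeSpace {P : Set Pt} (hP : IsClosed P) (r : ℝ) : IsClosed (freeSpace P r) := by
  -- An intersection of translates of `P`, each of them closed.
  have h : freeSpace P r = ⋂ x ∈ square 0 r, {p : Pt | p + x ∈ P} := by
    ext p
    simp only [freeSpace, square, Set.mem_ofPred_eq, Set.mem_iInter, Set.subset_def]
    constructor
    · intro h x hx
      exact h _ (by simpa [linfDist] using hx)
    · intro h x hx
      simpa using h (x - p) (by simpa [linfDist] using hx)
  rw [h]
  exact isClosed_biInter fun x _ => hP.preimage (by fun_prop)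

lemma isClosed_freeConfigs {P : Set Pt} (hP : IsClosed P) (k : ℕ) (r : ℝ) :
    IsClosed (freeConfigs P k r) := by
  simp only [freeConfigs, Set.ofPred_and, Set.ofPred_forall]
  refine IsClosed.inter ?_ ?_
  · exact isClosed_iInter fun i => (isClosed_freeSpace hP r).preimage (continuous_apply i)
  · refine isClosed_iInter fun i => isClosed_iInter fun j => isClosed_iInter fun _ => ?_
    have h : Continuous fun p : Config k => linfDist (p i) (p j) := by
      unfold linfDist; fun_prop
    exact isClosed_le continuous_const h

/-- Moving every robot by at most `δ` keeps a configuration free if the radius drops by `δ`. -/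
lemma mem_freeConfigs_of_dist_le {P : Set Pt} {r δ : ℝ} {p q : Config k}
    (hp : p ∈ freeConfigs P k (r + δ)) (hpq : dist q p ≤ δ) : q ∈ freeConfigs P k r := by
  have h (i : Fin k) : linfDist (q i) (p i) ≤ δ :=
    (linfDist_le_dist _ _).trans ((dist_le_pi_dist q p i).trans hpq)
  refine ⟨fun i x hx => hp.1 i ?_, fun i j hij => ?_⟩
  · exact (linfDist_triangle x (q i) (p i)).trans (add_le_add hx (h i))
  · have h1 := hp.2 i j hij
    have h2 := linfDist_triangle (p i) (q i) (p j)
    have h3 := linfDist_triangle (q i) (q j) (p j)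
    have h4 := h i
    rw [linfDist_comm] at h4
    linarith [h j]

lemma mem_of_mem_freeConfigs {P : Set Pt} {r : ℝ} (hr : 0 ≤ r) {p : Config k}
    (hp : p ∈ freeConfigs P k r) (i : Fin k) : p i ∈ P :=
  hp.1 i (by simpa [square, linfDist] using hr)

/-! ### Total distance and chains of configurations -/

/-- The sum over the robots of the Euclidean distances travelled from `p` to `q`. -/
noncomputable def sumDist (p q : Config k) : ℝ := ∑ i, dist (p i) (q i)

lemma sumDist_nonneg (p q : Config k) : 0 ≤ sumDist p q :=
  Finset.sum_nonneg fun _ _ => dist_nonneg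

lemma sumDist_self (p : Config k) : sumDist p p = 0 := by simp [sumDist]

lemma dist_le_sumDist (p q : Config k) : dist p q ≤ sumDist p q :=
  (dist_pi_le_iff (sumDist_nonneg p q)).2 fun i =>
    Finset.single_le_sum (f := fun i => dist (p i) (q i)) (fun _ _ => dist_nonneg)
      (Finset.mem_univ i)

lemma sumDist_triangle (p q r : Config k) : sumDist p r ≤ sumDist p q + sumDist q r := by
  rw [sumDist, sumDist, sumDist, ← Finset.sum_add_distrib]
  exact Finset.sum_le_sum fun i _ => dist_triangle _ _ _

/-- `v` runs from `s` to `t` inside `F` in `N` steps of size at most `δ`, and stays at `t`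
afterwards. -/
structure IsStepChain (F : Set (Config k)) (δ : ℝ) (s t : Config k) (N : ℕ)
    (v : ℕ → Config k) : Prop where
  source : v 0 = s
  target : ∀ j, N ≤ j → v j = t
  mem : ∀ j, v j ∈ F
  step : ∀ j, dist (v (j + 1)) (v j) ≤ δ

/-- The total length of the first `N` steps of `v`. -/
noncomputable def chainLength (N : ℕ) (v : ℕ → Config k) : ℝ :=
  ∑ j ∈ Finset.range N, sumDist (v j) (v (j + 1))

lemma chainLength_nonneg (N : ℕ) (v : ℕ → Config k) : 0 ≤ chainLength N v :=
  Finset.sum_nonneg fun _ _ => sumDist_nonneg _ _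

lemma dist_le_chainLength (N : ℕ) (v : ℕ → Config k) : dist (v 0) (v N) ≤ chainLength N v :=
  (dist_le_range_sum_dist v N).trans (Finset.sum_le_sum fun _ _ => dist_le_sumDist _ _)

lemma chainLength_mono {M N : ℕ} (h : M ≤ N) (v : ℕ → Config k) :
    chainLength M v ≤ chainLength N v :=
  Finset.sum_le_sum_of_subset_of_nonneg (Finset.range_mono h) fun _ _ _ => sumDist_nonneg _ _

lemma continuous_chainLength (N : ℕ) : Continuous (chainLength (k := k) N) := by
  unfold chainLength sumDist; fun_prop

namespace IsStepChain

variable {F : Set (Config k)} {δ : ℝ} {s t : Config k} {N : ℕ} {v : ℕ → Config k}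

/-- Staying at `t` forever lets chains of different sizes be compared with a common number of steps.
-/
lemma of_le (h : IsStepChain F δ s t N v) {M : ℕ} (hM : N ≤ M) : IsStepChain F δ s t M v :=
  ⟨h.source, fun j hj => h.target j (hM.trans hj), h.mem, h.step⟩

lemma chainLength_eq (h : IsStepChain F δ s t N v) {M : ℕ} (hM : N ≤ M) :
    chainLength M v = chainLength N v := by
  symm
  refine Finset.sum_subset (Finset.range_mono hM) fun j _ hj => ?_
  have hj : N ≤ j := by simpa using hj
  rw [h.target j hj, h.target (j + 1) (by omega), sumDist_self]

lemma dist_source_le (h : IsStepChain F δ s t N v) (j : ℕ) : dist (v j) s ≤ chainLength N v := by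
  rw [dist_comm, ← h.source]
  rcases le_total j N with hj | hj
  · exact (dist_le_chainLength j v).trans (chainLength_mono hj v)
  · exact (dist_le_chainLength j v).trans (h.chainLength_eq hj).le

/-- A vertex can be dropped if its two neighbours are close. -/
lemma exists_shortcut (h : IsStepChain F δ s t N v) {i : ℕ} (hi : i + 2 ≤ N)
    (hd : dist (v (i + 2)) (v i) ≤ δ) :
    ∃ w, IsStepChain F δ s t (N - 1) w ∧ chainLength (N - 1) w ≤ chainLength N v := by
  obtain ⟨r, rfl⟩ := Nat.exists_eq_add_of_le hi
  -- Vertex `i + 1` is deleted; `hd` bounds the one new step, and the triangle inequality its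
  -- length.
  refine ⟨fun j => if j ≤ i then v j else v (j + 1), ⟨?_, ?_, ?_, ?_⟩, ?_⟩
  · simpa using h.source
  · intro j hj
    rw [if_neg (by omega)]
    exact h.target _ (by omega)
  · intro j
    split_ifs <;> exact h.mem _
  · intro j
    rcases lt_trichotomy j i with hj | rfl | hj
    · simpa [hj.le, Nat.succ_le_of_lt hj] using h.step j
    · simpa using hd
    · simpa [hj.not_ge, show ¬ j + 1 ≤ i by omega] using h.step (j + 1)
  · have e1 : i + 2 + r - 1 = i + 1 + r := by omega
    rw [e1, chainLength, chainLength, Finset.sum_range_add _ (i + 1), Finset.sum_range_add _ (i + 2),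
      Finset.sum_range_succ _ (i + 1), Finset.sum_range_succ _ i, Finset.sum_range_succ _ i]
    have hA : ∑ j ∈ Finset.range i, sumDist (if j ≤ i then v j else v (j + 1))
        (if j + 1 ≤ i then v (j + 1) else v (j + 1 + 1)) =
        ∑ j ∈ Finset.range i, sumDist (v j) (v (j + 1)) := by
      refine Finset.sum_congr rfl fun j hj => ?_
      have hj := Finset.mem_range.1 hj
      rw [if_pos hj.le, if_pos (by omega)]
    have hB : ∑ j ∈ Finset.range r, sumDist (if i + 1 + j ≤ i then v (i + 1 + j)
        else v (i + 1 + j + 1)) (if i + 1 + j + 1 ≤ i then v (i + 1 + j + 1)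
        else v (i + 1 + j + 1 + 1)) =
        ∑ j ∈ Finset.range r, sumDist (v (i + 2 + j)) (v (i + 2 + j + 1)) := by
      refine Finset.sum_congr rfl fun j _ => ?_
      rw [if_neg (by omega), if_neg (by omega)]
      congr 2 <;> omega
    rw [hA, hB, if_pos le_rfl, if_neg (by omega)]
    have := sumDist_triangle (v i) (v (i + 1)) (v (i + 1 + 1))
    linarith

/-- A chain in which no vertex can be dropped has few steps. -/
lemma steps_le (hδ : 0 < δ) (hsep : ∀ i, i + 2 ≤ N → δ < dist (v (i + 2)) (v i)) :
    (N : ℝ) ≤ 2 * chainLength N v / δ + 1 := by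
  -- Steps are paired, each pair costing at least `δ`; an unpaired last step accounts for the `+ 1`.
  have key : ∀ m : ℕ, 2 * m ≤ N → (m : ℝ) * δ ≤ chainLength (2 * m) v := by
    intro m
    induction m with
    | zero => intro _; simp [chainLength]
    | succ m ih =>
      intro hm
      have h1 := ih (by omega)
      have h2 := hsep (2 * m) (by omega)
      have h3 := dist_le_sumDist (v (2 * m)) (v (2 * m + 2))
      have h4 := sumDist_triangle (v (2 * m)) (v (2 * m + 1)) (v (2 * m + 2))
      rw [dist_comm] at h2
      have h5 : chainLength (2 * (m + 1)) v = chainLength (2 * m) v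
          + sumDist (v (2 * m)) (v (2 * m + 1)) + sumDist (v (2 * m + 1)) (v (2 * m + 2)) := by
        rw [chainLength, show 2 * (m + 1) = 2 * m + 1 + 1 by ring, Finset.sum_range_succ,
          Finset.sum_range_succ, chainLength]
      push_cast
      linarith
  have h1 := (key (N / 2) (by omega)).trans (chainLength_mono (by omega : 2 * (N / 2) ≤ N) v)
  have h2 : (N : ℝ) ≤ 2 * ((N / 2 : ℕ) : ℝ) + 1 := by
    have : N ≤ 2 * (N / 2) + 1 := by omega
    exact_mod_cast this
  rw [← le_div_iff₀ hδ] at h1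
  rw [mul_div_assoc]
  linarith

/-- Dropping vertices as long as possible yields a chain with few steps. -/
lemma exists_short (hδ : 0 < δ) (h : IsStepChain F δ s t N v) :
    ∃ M w, IsStepChain F δ s t M w ∧ chainLength M w ≤ chainLength N v ∧
      (M : ℝ) ≤ 2 * chainLength M w / δ + 1 := by
  classical
  have hex : ∃ M w, IsStepChain F δ s t M w ∧ chainLength M w ≤ chainLength N v :=
    ⟨N, v, h, le_rfl⟩
  -- With the number of steps minimal, a droppable vertex would be a contradiction.
  obtain ⟨w, hw, hwl⟩ := Nat.find_spec hex
  refine ⟨Nat.find hex, w, hw, hwl, steps_le hδ fun i hi => ?_⟩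
  by_contra! hd
  obtain ⟨w', hw', hl'⟩ := hw.exists_shortcut hi hd
  exact Nat.find_min hex (by omega) ⟨w', hw', hl'.trans hwl⟩

/-- The infimum of the lengths of chains with a fixed number of steps is attained. -/
lemma exists_chainLength_le (hF : IsClosed F) {c : ℝ}
    (h : ∀ ε > 0, ∃ v, IsStepChain F δ s t N v ∧ chainLength N v ≤ c + ε) :
    ∃ v, IsStepChain F δ s t N v ∧ chainLength N v ≤ c := by
  set S : Set (ℕ → Config k) := {v | IsStepChain F δ s t N v}
  have hS : IsClosed S := by
    have : S = {v | v 0 = s} ∩ (⋂ j, ⋂ (_ : N ≤ j), {v | v j = t}) ∩ (⋂ j, {v | v j ∈ F}) ∩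
        ⋂ j, {v | dist (v (j + 1)) (v j) ≤ δ} := by
      ext v
      simp only [S, Set.mem_inter_iff, Set.mem_iInter, Set.mem_ofPred_eq]
      exact ⟨fun h => ⟨⟨⟨h.1, h.2⟩, h.3⟩, h.4⟩, fun h => ⟨h.1.1.1, h.1.1.2, h.1.2, h.2⟩⟩
    rw [this]
    refine (((isClosed_eq (by fun_prop) continuous_const).inter ?_).inter ?_).inter ?_
    · exact isClosed_iInter fun j => isClosed_iInter fun _ =>
        isClosed_eq (by fun_prop) continuous_const
    · exact isClosed_iInter fun j => hF.preimage (continuous_apply j)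
    · exact isClosed_iInter fun j => isClosed_le (by fun_prop) continuous_const
  -- A chain of length at most `c + 1` never leaves this ball around `s`, so Tychonoff applies.
  set K : Set (ℕ → Config k) := Set.pi Set.univ fun _ => Metric.closedBall s (c + 1)
  have hK : IsCompact (K ∩ S) :=
    (isCompact_univ_pi fun _ => isCompact_closedBall s (c + 1)).inter_right hS
  have hmem : ∀ v, IsStepChain F δ s t N v → chainLength N v ≤ c + 1 → v ∈ K ∩ S :=
    fun v hv hl => ⟨fun j _ => (hv.dist_source_le j).trans hl, hv⟩
  obtain ⟨v₁, hv₁, hl₁⟩ := h 1 one_pos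
  obtain ⟨v, hv, hmin⟩ := hK.exists_isMinOn ⟨v₁, hmem v₁ hv₁ hl₁⟩
    (continuous_chainLength N).continuousOn
  refine ⟨v, hv.2, le_of_forall_pos_le_add fun ε hε => ?_⟩
  obtain ⟨w, hw, hlw⟩ := h (min ε 1) (lt_min hε one_pos)
  have h1 : chainLength N v ≤ chainLength N w :=
    hmin (hmem w hw (hlw.trans (by gcongr; exact min_le_right _ _)))
  exact h1.trans (hlw.trans (by gcongr; exact min_le_left _ _))

end IsStepChain

/-! ### Sampling a plan -/

lemma ofReal_chainLength (N : ℕ) (v : ℕ → Config k) :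
    ENNReal.ofReal (chainLength N v) =
      ∑ i, ∑ j ∈ Finset.range N, edist (v (j + 1) i) (v j i) := by
  rw [chainLength, ENNReal.ofReal_sum_of_nonneg fun _ _ => sumDist_nonneg _ _, Finset.sum_comm]
  refine Finset.sum_congr rfl fun j _ => ?_
  rw [sumDist, ENNReal.ofReal_sum_of_nonneg fun _ _ => dist_nonneg]
  refine Finset.sum_congr rfl fun i _ => ?_
  rw [edist_dist, dist_comm]

lemma Plan.exists_isStepChain {P : Set Pt} {s t : Config k} (π : Plan P s t) {r δ : ℝ}
    (hπ : π.Feasible r) (hδ : 0 < δ) :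
    ∃ N v, IsStepChain (freeConfigs P k r) δ s t N v ∧
      ENNReal.ofReal (chainLength N v) ≤ π.cost := by
  have huc := isCompact_Icc.uniformContinuousOn_of_continuous π.continuousOn
  rw [Metric.uniformContinuousOn_iff] at huc
  obtain ⟨η, hη, huc⟩ := huc δ hδ
  -- Spacing `η / 2` meets the strict bound `η` of uniform continuity; truncation at `T` makes the
  -- chain rest at `t`.
  set u : ℕ → ℝ := fun j => min (j * (η / 2)) π.T with hu
  have hmono : Monotone u := by
    intro a b hab
    have : (a : ℝ) ≤ b := by exact_mod_cast hab
    simp only [hu]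
    gcongr
  have hmem (j : ℕ) : u j ∈ Set.Icc 0 π.T :=
    ⟨le_min (by positivity) π.T_nonneg, min_le_right _ _⟩
  obtain ⟨N, hN⟩ := exists_nat_ge (π.T / (η / 2))
  rw [div_le_iff₀ (by positivity)] at hN
  refine ⟨N, fun j => π.toFun (u j), ⟨?_, ?_, fun j => hπ _ (hmem j), fun j => ?_⟩, ?_⟩
  · simp [hu, π.T_nonneg, π.source]
  · intro j hj
    have h1 : (N : ℝ) * (η / 2) ≤ j * (η / 2) := by gcongr
    have h2 : u j = π.T := min_eq_right (hN.trans h1)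
    simp only [h2, π.target]
  · refine (huc _ (hmem _) _ (hmem _) ?_).le
    rw [Real.dist_eq, abs_of_nonneg (sub_nonneg.2 (hmono j.le_succ)), sub_lt_iff_lt_add]
    refine lt_of_le_of_lt ?_ (add_lt_add_left (half_lt_self hη) _)
    simp only [hu]
    push_cast
    rw [← min_add_add_left]
    exact min_le_min (by linarith) (by linarith)
  · rw [ofReal_chainLength, Plan.cost]
    exact Finset.sum_le_sum fun i _ =>
      eVariationOn.sum_le (f := fun u => π.toFun u i) hmono hmem

/-! ### Polygonal lines -/

/-- The polygonal line that runs through `v 0, ..., v N` at the times `0, ..., N`. -/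
noncomputable def polyline (N : ℕ) (v : ℕ → Config k) (u : ℝ) : Config k :=
  v 0 + ∑ j ∈ Finset.range N, max 0 (min 1 (u - j)) • (v (j + 1) - v j)

lemma continuous_polyline (N : ℕ) (v : ℕ → Config k) : Continuous (polyline N v) := by
  unfold polyline; fun_prop

/-- On this interval the ramps before index `j` have reached `1` and telescope, and those after it
are still `0`. -/
lemma polyline_eq {N j : ℕ} (hj : j < N) (v : ℕ → Config k) {u : ℝ}
    (hu : u ∈ Set.Icc (j : ℝ) (j + 1 : ℕ)) :
    polyline N v u = v j + (u - j) • (v (j + 1) - v j) := by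
  obtain ⟨r, rfl⟩ := Nat.exists_eq_add_of_lt hj
  have hu1 := hu.1
  have hu2 := hu.2
  push_cast at hu2
  rw [polyline, show j + r + 1 = j + 1 + r by ring, Finset.sum_range_add, Finset.sum_range_succ]
  have hA : ∑ i ∈ Finset.range j, max 0 (min 1 (u - i)) • (v (i + 1) - v i) = v j - v 0 := by
    rw [← Finset.sum_range_sub]
    refine Finset.sum_congr rfl fun i hi => ?_
    have : ((i + 1 : ℕ) : ℝ) ≤ j := by exact_mod_cast Finset.mem_range.1 hi
    push_cast at this
    rw [min_eq_left (by linarith), max_eq_right zero_le_one, one_smul]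
  have hB : ∑ i ∈ Finset.range r, max 0 (min 1 (u - (j + 1 + i : ℕ))) •
      (v (j + 1 + i + 1) - v (j + 1 + i)) = 0 := by
    refine Finset.sum_eq_zero fun i _ => ?_
    have h0 : (0 : ℝ) ≤ i := Nat.cast_nonneg i
    rw [max_eq_left, zero_smul]
    push_cast
    exact (min_le_right _ _).trans (by linarith)
  rw [hA, hB, min_eq_right (by linarith), max_eq_right (by linarith)]
  abel

lemma polyline_natCast {N j : ℕ} (hj : j ≤ N) (v : ℕ → Config k) : polyline N v j = v j := by
  rcases hj.lt_or_eq with hj | rfl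
  · rw [polyline_eq hj v (by simp)]; simp
  · rcases j with _ | j
    · simp [polyline]
    · rw [polyline_eq j.lt_succ_self v (by simp)]; simp

lemma exists_mem_Icc_natCast {N : ℕ} (hN : N ≠ 0) {u : ℝ} (hu : u ∈ Set.Icc (0 : ℝ) N) :
    ∃ j < N, u ∈ Set.Icc (j : ℝ) (j + 1 : ℕ) := by
  rcases hu.2.lt_or_eq with h | h
  · exact ⟨⌊u⌋₊, (Nat.floor_lt hu.1).2 h, Nat.floor_le hu.1, by
      push_cast; exact (Nat.lt_floor_add_one u).le⟩
  · obtain ⟨M, rfl⟩ := Nat.exists_eq_succ_of_ne_zero hN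
    exact ⟨M, M.lt_succ_self, by rw [h]; exact_mod_cast M.le_succ, h.le⟩

lemma exists_dist_polyline_le {N : ℕ} {v : ℕ → Config k} {δ : ℝ} (hδ : 0 ≤ δ)
    (hstep : ∀ j, dist (v (j + 1)) (v j) ≤ δ) {u : ℝ} (hu : u ∈ Set.Icc (0 : ℝ) N) :
    ∃ j, dist (polyline N v u) (v j) ≤ δ := by
  rcases eq_or_ne N 0 with rfl | hN
  · exact ⟨0, by simpa [polyline] using hδ⟩
  obtain ⟨j, hj, huj⟩ := exists_mem_Icc_natCast hN hu
  refine ⟨j, ?_⟩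
  have hu2 := huj.2
  push_cast at hu2
  rw [polyline_eq hj v huj, dist_eq_norm, add_sub_cancel_left, norm_smul,
    Real.norm_of_nonneg (by linarith [huj.1]), ← dist_eq_norm]
  exact (mul_le_of_le_one_left dist_nonneg (by linarith)).trans (hstep j)

/-- Variation is additive over the unit intervals; on each, the Lipschitz constant bounds it above
and the two endpoints below. -/
lemma eVariationOn_polyline (N : ℕ) (v : ℕ → Config k) (i : Fin k) :
    eVariationOn (fun u => polyline N v u i) (Set.Icc 0 N) =
      ∑ j ∈ Finset.range N, edist (v (j + 1) i) (v j i) := by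
  have hmono : Monotone fun j : ℕ => (j : ℝ) := Nat.mono_cast
  have hsum := eVariationOn.sum' (fun u => polyline N v u i) hmono (n := N)
  rw [← Nat.cast_zero (R := ℝ), ← hsum]
  refine Finset.sum_congr rfl fun j hj => ?_
  have hj := Finset.mem_range.1 hj
  refine le_antisymm ?_ ?_
  · have hlip : LipschitzOnWith (nndist (v (j + 1) i) (v j i)) (fun u => polyline N v u i)
        (Set.Icc (j : ℝ) (j + 1 : ℕ)) := by
      refine LipschitzOnWith.of_dist_le_mul fun x hx y hy => ?_
      rw [polyline_eq hj v hx, polyline_eq hj v hy]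
      simp only [Pi.add_apply, Pi.smul_apply, Pi.sub_apply, dist_add_left, coe_nndist]
      rw [dist_eq_norm, ← sub_smul, norm_smul, mul_comm, Real.norm_eq_abs,
        sub_sub_sub_cancel_right, ← dist_eq_norm, Real.dist_eq]
    have h1 := hlip.comp_eVariationOn_le (g := id) (Set.mapsTo_id _)
    have h2 : eVariationOn (id : ℝ → ℝ) (Set.Icc (j : ℝ) (j + 1 : ℕ)) ≤ 1 := by
      simp
    rw [edist_nndist]
    exact h1.trans (mul_le_of_le_one_right' h2)
  · have := eVariationOn.edist_le (fun u => polyline N v u i)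
      (s := Set.Icc (j : ℝ) (j + 1 : ℕ)) (x := (j + 1 : ℕ)) (y := j) (by simp) (by simp)
    simpa only [polyline_natCast hj.le, polyline_natCast (Nat.succ_le_of_lt hj)] using this

namespace IsStepChain

variable {P : Set Pt} {s t : Config k} {r δ : ℝ} {N : ℕ} {v : ℕ → Config k}

lemma polyline_mem (h : IsStepChain (freeConfigs P k (r + δ)) δ s t N v) (hδ : 0 ≤ δ) {u : ℝ}
    (hu : u ∈ Set.Icc (0 : ℝ) N) : polyline N v u ∈ freeConfigs P k r := by
  obtain ⟨j, hj⟩ := exists_dist_polyline_le hδ h.step hu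
  exact mem_freeConfigs_of_dist_le (h.mem j) hj

/-- The polygonal plan through the vertices of a chain. -/
noncomputable def toPlan (h : IsStepChain (freeConfigs P k (r + δ)) δ s t N v) (hr : 0 ≤ r) (hδ : 0 ≤ δ) :
    Plan P s t where
  T := N
  T_nonneg := N.cast_nonneg
  toFun := polyline N v
  continuousOn := (continuous_polyline N v).continuousOn
  mem _ hu i := mem_of_mem_freeConfigs hr (h.polyline_mem hδ hu) i
  source := by
    rw [← h.source, ← polyline_natCast N.zero_le v, Nat.cast_zero]
  target := by rw [polyline_natCast le_rfl, h.target N le_rfl]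

variable (h : IsStepChain (freeConfigs P k (r + δ)) δ s t N v) (hr : 0 ≤ r) (hδ : 0 ≤ δ)

lemma feasible_toPlan : (h.toPlan hr hδ).Feasible r := fun _ hu => h.polyline_mem hδ hu

lemma cost_toPlan : (h.toPlan hr hδ).cost = ENNReal.ofReal (chainLength N v) := by
  rw [ofReal_chainLength]
  exact Finset.sum_congr rfl fun i _ => eVariationOn_polyline N v i

lemma linearOn_toPlan {j : ℕ} (hj : j < N) :
    (h.toPlan hr hδ).LinearOn (Set.Icc (j : ℝ) (j + 1 : ℕ)) := by
  refine ⟨v j - (j : ℝ) • (v (j + 1) - v j), v (j + 1) - v j, fun u hu => ?_⟩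
  refine (polyline_eq hj v hu).trans ?_
  rw [sub_smul]
  abel

lemma piecewiseLinear_toPlan : (h.toPlan hr hδ).PiecewiseLinear := by
  refine ⟨N, fun j => (j : ℕ), fun a b hab => ?_, by simp, by simp [toPlan], fun j => ?_⟩
  · simpa using hab
  · simpa using h.linearOn_toPlan hr hδ j.2

/-- Around a non-integer time the plan is linear, so only the times `0, ..., N` can be breakpoints.
-/
lemma numBreakpoints_toPlan_le : (h.toPlan hr hδ).numBreakpoints ≤ (N + 1 : ℕ) := by
  classical
  have hsub : (h.toPlan hr hδ).breakTimes ⊆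
      ((Finset.range (N + 1)).image (fun j : ℕ => (j : ℝ)) : Finset ℝ) := by
    rintro u ⟨hu, hnot⟩
    by_contra hmem
    have hne (j : ℕ) (hj : j ≤ N) : u ≠ j := by
      rintro rfl
      exact hmem (by simpa using Nat.lt_succ_of_le hj)
    have hN : N ≠ 0 := by
      rintro rfl
      have hu1 : u ∈ Set.Icc (0 : ℝ) (0 : ℕ) := hu
      exact hne 0 le_rfl (by push_cast at hu1 ⊢; exact le_antisymm hu1.2 hu1.1)
    obtain ⟨j, hj, huj⟩ := exists_mem_Icc_natCast hN hu
    have h1 : (j : ℝ) < u := lt_of_le_of_ne huj.1 (hne j hj.le).symm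
    have h2 : u < (j + 1 : ℕ) := lt_of_le_of_ne huj.2 (hne (j + 1) hj)
    have hI : Set.Icc (u - min (u - j) ((j + 1 : ℕ) - u)) (u + min (u - j) ((j + 1 : ℕ) - u)) ⊆
        Set.Icc (j : ℝ) (j + 1 : ℕ) := by
      refine Set.Icc_subset_Icc ?_ ?_
      · linarith [min_le_left (u - j) ((j + 1 : ℕ) - u)]
      · linarith [min_le_right (u - j) ((j + 1 : ℕ) - u)]
    obtain ⟨a, b, hab⟩ := h.linearOn_toPlan hr hδ hj
    refine hnot ⟨min (u - j) ((j + 1 : ℕ) - u), lt_min (sub_pos.2 h1) (sub_pos.2 h2),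
      hI.trans (Set.Icc_subset_Icc j.cast_nonneg ?_), a, b, fun x hx => hab x (hI hx)⟩
    change ((j + 1 : ℕ) : ℝ) ≤ (N : ℝ)
    exact_mod_cast hj
  refine (Set.encard_le_encard hsub).trans ?_
  rw [Set.encard_coe_eq_coe_finsetCard]
  exact_mod_cast Finset.card_image_le.trans (Finset.card_range _).le

end IsStepChain

/-! ### Short chains of optimal length -/

/-- Robust plans can be replaced by chains that have few steps and are at most as long as an
optimal plan. -/
lemma exists_isStepChain_le_OPT {P : Set Pt} (hP : IsClosed P) {s t : Config k} {r δ : ℝ}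
    (hδ : 0 < δ) (hπ : ∃ π : Plan P s t, π.Feasible r) :
    ∃ N v, IsStepChain (freeConfigs P k r) δ s t N v ∧
      ENNReal.ofReal (chainLength N v) ≤ OPT P s t r ∧
      (N : ℝ) ≤ 2 * chainLength N v / δ + 1 := by
  rcases eq_or_ne (OPT P s t r) ⊤ with htop | htop
  -- If every feasible plan has infinite length, any sampled chain will do.
  · obtain ⟨π, hπ⟩ := hπ
    obtain ⟨N, v, hv, -⟩ := π.exists_isStepChain hπ hδ
    obtain ⟨M, w, hw, -, hM⟩ := hv.exists_short hδ
    exact ⟨M, w, hw, by simp [htop], hM⟩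
  set c := (OPT P s t r).toReal
  have hc : ENNReal.ofReal c = OPT P s t r := ENNReal.ofReal_toReal htop
  have happrox : ∀ ε > 0, ∃ N v, IsStepChain (freeConfigs P k r) δ s t N v ∧
      chainLength N v ≤ c + ε ∧ (N : ℝ) ≤ 2 * chainLength N v / δ + 1 := by
    intro ε hε
    have hlt : OPT P s t r < ENNReal.ofReal (c + ε) := by
      rw [← hc]
      exact (ENNReal.ofReal_lt_ofReal_iff
        (add_pos_of_nonneg_of_pos ENNReal.toReal_nonneg hε)).2 (lt_add_of_pos_right c hε)
    simp only [OPT, iInf_lt_iff] at hlt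
    obtain ⟨π, hf, hlt⟩ := hlt
    obtain ⟨N, v, hv, hl⟩ := π.exists_isStepChain hf hδ
    obtain ⟨M, w, hw, hwl, hM⟩ := hv.exists_short hδ
    refine ⟨M, w, hw, hwl.trans ?_, hM⟩
    exact (ENNReal.ofReal_le_ofReal_iff
      (add_pos_of_nonneg_of_pos ENNReal.toReal_nonneg hε).le).1 (hl.trans hlt.le)
  -- With errors capped at `1`, all approximating chains have length at most `c + 1`, hence at most
  -- `B` steps.
  obtain ⟨B, hB⟩ := exists_nat_ge (2 * (c + 1) / δ + 1)
  obtain ⟨v, hv, hvl⟩ : ∃ v, IsStepChain (freeConfigs P k r) δ s t B v ∧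
      chainLength B v ≤ c := by
    refine IsStepChain.exists_chainLength_le (isClosed_freeConfigs hP k r) fun ε hε => ?_
    obtain ⟨N, v, hv, hl, hN⟩ := happrox (min ε 1) (lt_min hε one_pos)
    have hNB : N ≤ B := by
      have h1 : chainLength N v ≤ c + 1 := hl.trans (by gcongr; exact min_le_right _ _)
      have h2 : (N : ℝ) ≤ B := hN.trans (le_trans (by gcongr) hB)
      exact_mod_cast h2
    refine ⟨v, hv.of_le hNB, ?_⟩
    rw [hv.chainLength_eq hNB]
    exact hl.trans (by gcongr; exact min_le_left _ _)
  -- `B` is governed by `c`, not by the length of `v`, which may be smaller; shortening again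
  -- restores the bound in terms of the chain's own length.
  obtain ⟨M, w, hw, hwl, hM⟩ := hv.exists_short hδ
  refine ⟨M, w, hw, ?_, hM⟩
  rw [← hc]
  exact ENNReal.ofReal_le_ofReal (hwl.trans hvl)

lemma two_mul_div_add_two_le {ρ l : ℝ} (hk : 1 ≤ k) (hρ : 0 < ρ) (hl : 0 ≤ l) :
    2 * l / ρ + 2 ≤ max 2 ((k : ℝ) / ρ) ^ (2 * k ^ 2) * (l + 1) := by
  set m := max 2 ((k : ℝ) / ρ)
  have hm : 2 ≤ m := le_max_left _ _
  have hk' : (1 : ℝ) ≤ k := by exact_mod_cast hk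
  have hρm : 1 / ρ ≤ m := (div_le_div_of_nonneg_right hk' hρ.le).trans (le_max_right _ _)
  have hpow : m ^ 2 ≤ m ^ (2 * k ^ 2) :=
    pow_le_pow_right₀ (by linarith) (by nlinarith [Nat.one_le_pow 2 k hk])
  have h1 : 2 * (1 / ρ) ≤ m ^ 2 := by
    rw [sq]; exact mul_le_mul hm hρm (by positivity) (by linarith)
  calc 2 * l / ρ + 2 = 2 * (1 / ρ) * l + 2 := by ring
    _ ≤ m ^ 2 * l + m ^ 2 := by gcongr; nlinarith
    _ = m ^ 2 * (l + 1) := by ring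
    _ ≤ _ := by gcongr

end MinSum

theorem lemma3 :
    ∃ C : ℕ, ∀ (k : ℕ) (_ : 1 ≤ k) (ρ : ℝ) (_ : 0 < ρ)
      (P : Set Pt) (_ : IsPolygonalEnvironment P) (s t : Config k)
      (_ : s ∈ freeConfigs P k 1) (_ : t ∈ freeConfigs P k 1)
      (_ : RobustlyReachable P s t ρ),
      ∃ π : Plan P s t, π.Feasible 1 ∧ π.PiecewiseLinear ∧
        π.cost ≤ OPT P s t (1 + ρ) ∧
        (π.numBreakpoints : ENNReal) ≤
          ENNReal.ofReal (max 2 ((k : ℝ) / ρ) ^ (C * k ^ 2)) * (π.cost + 1) := by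
  -- `C = 2` suffices: `1/ρ ≤ k/ρ`, so the square of `max 2 (k/ρ)` already absorbs the factor `2/ρ`
  -- and the constant `2`.
  refine ⟨2, fun k hk ρ hρ P hP s t _ _ ⟨π₀, hπ₀⟩ => ?_⟩
  obtain ⟨N, v, hv, hl, hN⟩ := exists_isStepChain_le_OPT hP.isClosed hρ ⟨π₀, hπ₀.2⟩
  refine ⟨hv.toPlan zero_le_one hρ.le, hv.feasible_toPlan _ _, hv.piecewiseLinear_toPlan _ _,
    by rwa [hv.cost_toPlan], ?_⟩
  have hl0 := chainLength_nonneg N v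
  have hb : ((hv.toPlan zero_le_one hρ.le).numBreakpoints : ENNReal) ≤ ((N + 1 : ℕ) : ENNReal) := by
    exact_mod_cast ENat.toENNReal_le.2 (hv.numBreakpoints_toPlan_le zero_le_one hρ.le)
  rw [hv.cost_toPlan, ← ENNReal.ofReal_one, ← ENNReal.ofReal_add hl0 zero_le_one,
    ← ENNReal.ofReal_mul (by positivity)]
  refine hb.trans ?_
  rw [← ENNReal.ofReal_natCast]
  refine ENNReal.ofReal_le_ofReal (le_trans ?_ (two_mul_div_add_two_le hk hρ hl0))
  push_cast
  linarith
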